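/- Let $\mathbb R^m$ carry its standard scalar product $\langle\cdot,\cdot\rangle$. A simplicial cone in $\mathbb R^m$ is a set $K=\{t_1x^1+\dots+t_mx^m : t_1,\dots,t_m\ge 0\}$ with $x^1,\dots,x^m\in\mathbb R^m$ linearly independent; its dual is $K^*=\{y\in\mathbb R^m : \langle x,y\rangle\ge 0\ \ \forall x\in K\}$. For a linear map $A:\mathbb R^m\to\mathbb R^m$ and $q\in\mathbb R^m$, the problem $\mathrm{LCP}(K,A,q)$ is to find $x\in K$ with $Ax+q\in K^*$ and $\langle x,Ax+q\rangle=0$. The map $A$ has the $K$-Q-property if $\mathrm{LCP}(K,A,q)$ has a solution for every $q\in\mathbb R^m$, the $K$-P-property if $\mathrm{LCP}(K,A,q)$ has a unique solution for every $q\in\mathbb R^m$, and the $K$-F-property (general feasibility) if $(AK+q)\cap K^*\neq\varnothing$ for every $q\in\mathbb R^m$. **Corollary.** Let $A:\mathbb R^m\to\mathbb R^m$ be an invertible linear map. Then the following three assertions are equivalent: $A$ has the $K$-F-property for every simplicial cone $K$; $A$ has the $K$-Q-property for every simplicial cone $K$; $A$ has the $K$-P-property for every simplicial cone $K$. Moreover,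 exactly one of the following alternatives holds: 1. $A$ has the $K$-F-property (equivalently the $K$-Q-property, equivalently the $K$-P-property) for every simplicial cone $K$. 2. There is no simplicial cone $K$ for which $A$ has the $K$-F-property. 3. There exist a simplicial cone $K$ for which $A$ does not have the $K$-F-property and a simplicial cone $L$ for which $A$ has the $L$-Q-property. -/

import Mathlib

/-- A simplicial cone in `ℝ^m`: the set of all nonnegative combinations of `m` linearly
independent vectors (it is therefore automatically generating). -/
def IsSimplicialCone {m : ℕ} (K : Set (EuclideanSpace ℝ (Fin m))) : Prop :=
  ∃ x : Fin m → EuclideanSpace ℝ (Fin m), LinearIndependent ℝ x ∧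
    K = {y | ∃ t : Fin m → ℝ, (∀ i, 0 ≤ t i) ∧ y = ∑ i, t i • x i}

/-- `x` solves the linear complementarity problem `LCP(K, A, q)`:
`x ∈ K`, `A x + q ∈ K*` and `⟨x, A x + q⟩ = 0`, where `K*` is the dual cone. -/
def IsLCPSolution {m : ℕ} (K : Set (EuclideanSpace ℝ (Fin m)))
    (A : EuclideanSpace ℝ (Fin m) →ₗ[ℝ] EuclideanSpace ℝ (Fin m))
    (q x : EuclideanSpace ℝ (Fin m)) : Prop :=
  x ∈ K ∧ A x + q ∈ ProperCone.innerDual K ∧ inner ℝ x (A x + q) = 0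

/-- The `K`-Q-property: `LCP(K, A, q)` has a solution for all `q`. -/
def HasQProperty {m : ℕ} (K : Set (EuclideanSpace ℝ (Fin m)))
    (A : EuclideanSpace ℝ (Fin m) →ₗ[ℝ] EuclideanSpace ℝ (Fin m)) : Prop :=
  ∀ q, ∃ x, IsLCPSolution K A q x

/-- The `K`-P-property: `LCP(K, A, q)` has a unique solution for all `q`. -/
def HasPProperty {m : ℕ} (K : Set (EuclideanSpace ℝ (Fin m)))
    (A : EuclideanSpace ℝ (Fin m) →ₗ[ℝ] EuclideanSpace ℝ (Fin m)) : Prop :=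
  ∀ q, ∃! x, IsLCPSolution K A q x

/-- The general feasibility property with respect to `K` (the `K`-F-property):
`(A K + q) ∩ K*` is nonempty for all `q`. -/
def HasFProperty {m : ℕ} (K : Set (EuclideanSpace ℝ (Fin m)))
    (A : EuclideanSpace ℝ (Fin m) →ₗ[ℝ] EuclideanSpace ℝ (Fin m)) : Prop :=
  ∀ q, ((fun x => A x + q) '' K ∩ (ProperCone.innerDual K : Set _)).Nonempty

/-- Exactly one of three propositions holds. -/
def ExactlyOneOfThree (a b c : Prop) : Prop :=
  (a ∨ b ∨ c) ∧ ¬ (a ∧ b) ∧ ¬ (a ∧ c) ∧ ¬ (b ∧ c)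

/-! Everything is read off the quadratic form `⟨x, A x⟩`. If `⟨x, A x⟩ ≤ 0` for some `x ≠ 0`, then
`x` extends to a basis inside the half-space `⟨x, A v⟩ ≤ 0`, and on the cone of that basis `q = -x`
is infeasible (`exists_not_hasFProperty`). So feasibility on all cones forces positive definiteness,
which gives unique solvability on every cone via a variational inequality (`hasPProperty_of_pos`).

For the trichotomy, feasibility on one cone yields a vector with `⟨x, A x⟩ > 0` when `m > 0`. One
positive vector suffices to build a cone with the Q-property: for `B x y = ⟨x, A y⟩`, induction on
the dimension finds a basis whose matrix `B (y i) (y j)` makes every LCP solvable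
(`exists_linearIndependent_lcpSolvable`). Either some positive `x` has another positive vector in
`{w | B w x = 0}`, and one recurses there; or `B` is nonpositive on all such hyperplanes, hence
symmetric on them, and a perturbed orthogonal basis works. -/

/-- Every linear complementarity problem with the square matrix `M` is solvable. -/
def LCPSolvable {n : ℕ} (M : Fin n → Fin n → ℝ) : Prop :=
  ∀ q : Fin n → ℝ, ∃ z : Fin n → ℝ, (∀ i, 0 ≤ z i) ∧ (∀ i, 0 ≤ ∑ j, M i j * z j + q i) ∧
    ∀ i, z i * (∑ j, M i j * z j + q i) = 0

/-- If `q` has a negative entry, a solution lives on the single coordinate `j` where `q` is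
smallest: it makes row `j` vanish and raises every other row by at least `-q j`. -/
theorem LCPSolvable.of_diag_le {n : ℕ} {M : Fin n → Fin n → ℝ} (hpos : ∀ j, 0 < M j j)
    (hle : ∀ i j, M j j ≤ M i j) : LCPSolvable M := by
  intro q
  by_cases hq : ∀ i, 0 ≤ q i
  · exact ⟨0, by simp, by simpa using hq, by simp⟩
  push Not at hq
  obtain ⟨i₀, hi₀⟩ := hq
  obtain ⟨j, -, hj⟩ := Finset.exists_min_image Finset.univ q ⟨i₀, Finset.mem_univ _⟩
  have hqj : q j < 0 := (hj i₀ (Finset.mem_univ _)).trans_lt hi₀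
  have hsum : ∀ i, ∑ k, M i k * (Pi.single j (-q j / M j j) : Fin n → ℝ) k
      = M i j * (-q j / M j j) := by
    intro i
    rw [Finset.sum_eq_single j]
    · simp
    · intro k _ hk
      simp [hk]
    · simp
  have ht : 0 < -q j / M j j := div_pos (by linarith) (hpos j)
  have hjj : M j j * (-q j / M j j) = -q j := mul_div_cancel₀ _ (hpos j).ne'
  refine ⟨Pi.single j (-q j / M j j), fun i => ?_, fun i => ?_, fun i => ?_⟩
  · by_cases h : i = j
    · subst h; simpa using ht.le
    · simp [h]
  · rw [hsum]
    have h1 := mul_le_mul_of_nonneg_right (hle i j) ht.le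
    have h2 := hj i (Finset.mem_univ _)
    linarith
  · by_cases h : i = j
    · subst h; rw [hsum, hjj]; simp
    · simp [h]

/-- The zero column decouples the lower rows from coordinate `0`, so the smaller problem is solved
first and a scalar LCP with positive coefficient remains. -/
theorem LCPSolvable.of_block {n : ℕ} {M : Fin (n + 1) → Fin (n + 1) → ℝ} (h0 : 0 < M 0 0)
    (hcol : ∀ i : Fin n, M i.succ 0 = 0)
    (hM : LCPSolvable fun i j : Fin n => M i.succ j.succ) : LCPSolvable M := by
  intro q
  obtain ⟨z, hz, hw, hzw⟩ := hM fun i => q i.succ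
  set s := ∑ j : Fin n, M 0 j.succ * z j + q 0 with hs
  have hrow : ∀ t : ℝ, ∑ j, M 0 j * (Fin.cons t z : Fin (n + 1) → ℝ) j + q 0
      = M 0 0 * t + s := by
    intro t
    rw [Fin.sum_univ_succ]
    simp [hs, add_assoc]
  have hrest : ∀ t : ℝ, ∀ i : Fin n,
      ∑ j, M i.succ j * (Fin.cons t z : Fin (n + 1) → ℝ) j + q i.succ
      = ∑ j : Fin n, M i.succ j.succ * z j + q i.succ := by
    intro t i
    rw [Fin.sum_univ_succ]
    simp [hcol]
  obtain ⟨t, ht, hs1, hs2⟩ : ∃ t : ℝ, 0 ≤ t ∧ 0 ≤ M 0 0 * t + s ∧ t * (M 0 0 * t + s) = 0 := by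
    rcases le_total 0 s with h | h
    · exact ⟨0, le_rfl, by simpa using h, by simp⟩
    · have : M 0 0 * (-s / M 0 0) = -s := mul_div_cancel₀ _ h0.ne'
      exact ⟨-s / M 0 0, div_nonneg (by linarith) h0.le, by rw [this]; simp, by rw [this]; simp⟩
  refine ⟨Fin.cons t z, fun i => ?_, fun i => ?_, fun i => ?_⟩ <;>
    refine Fin.cases ?_ (fun k => ?_) i
  · exact ht
  · exact hz k
  · rw [hrow]; exact hs1
  · rw [hrest]; exact hw k
  · rw [hrow]; exact hs2
  · rw [hrest]; exact hzw k

/-! ### Bases adapted to a bilinear form with a positive vector -/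

section BilinearForm

variable {V : Type*} [AddCommGroup V] [Module ℝ V]

/-- An affine function of one variable that is bounded above is constant. -/
theorem eq_zero_of_forall_mul_add_nonpos {a c : ℝ} (h : ∀ t : ℝ, t * a + c ≤ 0) : a = 0 := by
  by_contra ha
  have := h ((1 - c) / a)
  rw [div_mul_cancel₀ _ ha] at this
  linarith

/-- Since `α x + v` is positive for large `|α|`, no vector in its right orthogonal space can be
positive. At the limiting value `α ^ 2 = b ^ 2`, this inequality along `t • v + g` loses its `t ^ 2`
term, so its linear coefficient must vanish; the two signs of `α` then isolate `B v g - B g v`. -/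
theorem bilin_symm_of_right_orthogonal {B : V →ₗ[ℝ] V →ₗ[ℝ] ℝ}
    (hB : ∀ x w, 0 < B x x → B w x = 0 → B w w ≤ 0) {x : V} (hx : 0 < B x x) {v g : V}
    (hvx : B v x = 0) (hxv : B x v = 0) (hgx : B g x = 0) : B v g = B g v := by
  have hv : B v v ≤ 0 := hB x v hx hvx
  obtain ⟨b, hb0, hb⟩ : ∃ b : ℝ, 0 ≤ b ∧ b ^ 2 * B x x = -B v v :=
    ⟨√(-B v v / B x x), Real.sqrt_nonneg _, by
      rw [Real.sq_sqrt (div_nonneg (by linarith) hx.le), div_mul_cancel₀ _ hx.ne']⟩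
  -- The vector `α x + v` is positive, hence `B` is nonpositive on its right orthogonal space.
  have key : ∀ (u : V), B u x = 0 → ∀ α : ℝ, b ^ 2 < α ^ 2 →
      (B v u) ^ 2 + α * B v u * B x u + α ^ 2 * B x x * B u u ≤ 0 := by
    intro u hu α hα
    have hα0 : α ≠ 0 := by
      rintro rfl
      nlinarith [sq_nonneg b]
    have hw : 0 < B (α • x + v) (α • x + v) := by
      simp only [map_add, map_smul, LinearMap.add_apply, LinearMap.smul_apply, smul_eq_mul, hvx,
        hxv]
      nlinarith [mul_lt_mul_of_pos_right hα hx]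
    have hwy : B (α • x + v) ((α * B x x) • u - (α * B x u + B v u) • x) = 0 := by
      simp only [map_add, map_sub, map_smul, LinearMap.add_apply, LinearMap.smul_apply,
        smul_eq_mul, hvx]
      ring
    have hyy : ¬ 0 < B ((α * B x x) • u - (α * B x u + B v u) • x)
        ((α * B x x) • u - (α * B x u + B v u) • x) := fun h => by
      have := hB _ _ h hwy
      linarith
    have hexp : B ((α * B x x) • u - (α * B x u + B v u) • x)
        ((α * B x x) • u - (α * B x u + B v u) • x)
        = B x x * ((B v u) ^ 2 + α * B v u * B x u + α ^ 2 * B x x * B u u) := by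
      simp only [map_sub, map_smul, LinearMap.sub_apply, LinearMap.smul_apply,
        smul_eq_mul, hu]
      ring
    rw [hexp] at hyy
    by_contra hcon
    exact hyy (mul_pos hx (not_le.mp hcon))
  have key' : ∀ (u : V), B u x = 0 → ∀ α : ℝ, α ^ 2 = b ^ 2 →
      (B v u) ^ 2 + α * B v u * B x u + α ^ 2 * B x x * B u u ≤ 0 := by
    -- Approach `α` with slightly larger absolute value, moving away from `0` according to its sign.
    intro u hu α hα
    have hc : Filter.Tendsto (fun δ : ℝ => (B v u) ^ 2 + (α + (if 0 ≤ α then δ else -δ)) * B v u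
        * B x u + (α + (if 0 ≤ α then δ else -δ)) ^ 2 * B x x * B u u) (nhdsWithin 0 (Set.Ioi 0))
        (nhds ((B v u) ^ 2 + α * B v u * B x u + α ^ 2 * B x x * B u u)) := by
      apply tendsto_nhdsWithin_of_tendsto_nhds
      refine Continuous.tendsto' ?_ _ _ (by split_ifs <;> simp)
      split_ifs <;> fun_prop
    refine le_of_tendsto hc ?_
    filter_upwards [self_mem_nhdsWithin] with δ hδ
    refine key u hu _ ?_
    have hδ : 0 < δ := hδ
    rw [← hα]
    split_ifs with h <;> nlinarith
  have lin : ∀ α : ℝ, α ^ 2 = b ^ 2 →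
      B v v * (B v g - B g v) + α * B v v * B x g = 0 := by
    intro α hα
    refine eq_zero_of_forall_mul_add_nonpos
      (c := B v g ^ 2 + α * B v g * B x g - B v v * B g g) fun t => ?_
    have h := key' (t • v + g) (by simp [hvx, hgx]) α hα
    have hα' : α ^ 2 * B x x = -B v v := by rw [hα, hb]
    rw [hα'] at h
    simp only [map_add, map_smul, LinearMap.add_apply, LinearMap.smul_apply, smul_eq_mul,
      hxv] at h
    linarith
  rcases hv.lt_or_eq with hv | hv
  · have h1 := lin b rfl
    have h2 := lin (-b) (by ring)
    have : B v v * (B v g - B g v) = 0 := by linarith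
    rcases mul_eq_zero.mp this with h | h
    · exact absurd h hv.ne
    · linarith
  -- When `B v v = 0` the linear coefficient carries no information; instead `α = 0` and the
  -- hypothesis at `x` make both values vanish.
  · have hb' : b = 0 := by
      rw [hv, neg_zero] at hb
      simpa [hx.ne'] using hb
    have hp : B v g = 0 := by
      have := key' g hgx 0 (by simp [hb'])
      simp only [zero_mul, add_zero, ne_eq, OfNat.ofNat_ne_zero, not_false_eq_true, zero_pow] at this
      exact pow_eq_zero_iff (two_ne_zero) |>.mp (le_antisymm this (sq_nonneg _))
    have hp' : B g v = 0 := by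
      refine eq_zero_of_forall_mul_add_nonpos (c := B g g) fun t => ?_
      have := hB x (t • v + g) hx (by simp [hvx, hgx])
      simp only [map_add, map_smul, LinearMap.add_apply, LinearMap.smul_apply, smul_eq_mul,
        hv, hp] at this
      linarith
    rw [hp, hp']

theorem bilin_symm_on_orthogonal {B : V →ₗ[ℝ] V →ₗ[ℝ] ℝ}
    (hB : ∀ x w, 0 < B x x → B w x = 0 → B w w ≤ 0) {x : V} (hx : 0 < B x x) {g h : V}
    (hgx : B g x = 0) (hhx : B h x = 0) : B g h = B h g := by
  by_cases hg : B x g = 0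
  · exact bilin_symm_of_right_orthogonal hB hx hgx hg hhx
  -- This combination of `g` and `h` is orthogonal to `x` on both sides, and its `g` part cancels
  -- from the symmetry relation.
  · have := bilin_symm_of_right_orthogonal hB hx (v := B x g • h - B x h • g) (g := g)
      (by simp [hgx, hhx]) (by simp [mul_comm]) hgx
    simp only [map_sub, map_smul, LinearMap.sub_apply, LinearMap.smul_apply, smul_eq_mul] at this
    have h2 : B x g * (B h g - B g h) = 0 := by linarith
    rcases mul_eq_zero.mp h2 with h3 | h3
    · exact absurd h3 hg
    · linarith

theorem exists_linearIndependent_lcpSolvable (n : ℕ) {V : Type*} [AddCommGroup V] [Module ℝ V]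
    [FiniteDimensional ℝ V] (hn : Module.finrank ℝ V = n) (B : V →ₗ[ℝ] V →ₗ[ℝ] ℝ)
    (hpos : ∃ x, 0 < B x x) :
    ∃ y : Fin n → V, LinearIndependent ℝ y ∧ LCPSolvable fun i j => B (y i) (y j) := by
  induction n generalizing V with
  | zero =>
    obtain ⟨x, hx⟩ := hpos
    have := Module.finrank_zero_iff.mp hn
    rw [Subsingleton.elim x 0] at hx
    simp at hx
  | succ n ih =>
    have hker : ∀ x, 0 < B x x → Module.finrank ℝ (LinearMap.ker (B.flip x)) = n := by
      intro x hx
      have hne : B.flip x ≠ 0 := fun h => hx.ne' (by simpa using LinearMap.congr_fun h x)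
      have := Module.Dual.finrank_ker_add_one_of_ne_zero (f := B.flip x) hne
      omega
    by_cases hB : ∀ x w, 0 < B x x → B w x = 0 → B w w ≤ 0
    · obtain ⟨x, hx⟩ := hpos
      set W := LinearMap.ker (B.flip x) with hW
      have hWx : ∀ w : W, B w x = 0 := fun w => LinearMap.mem_ker.mp w.2
      let C : LinearMap.BilinForm ℝ W := B.domRestrict₁₂ W W
      have hC : ∀ v w : W, C v w = B v w := fun v w => rfl
      have hsymm : LinearMap.IsSymm C := ⟨fun v w => by
        simpa [hC] using bilin_symm_on_orthogonal hB hx (hWx v) (hWx w)⟩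
      obtain ⟨e', he'⟩ := LinearMap.BilinForm.exists_orthogonal_basis hsymm
      let e := e'.reindex (finCongr (hker x hx))
      have he : ∀ i j, i ≠ j → B (e i) (e j) = 0 := by
        intro i j hij
        have := he' (i := (finCongr (hker x hx)).symm i) (j := (finCongr (hker x hx)).symm j)
          (by simpa using hij)
        simpa [e, Function.onFun, hC] using this
      obtain ⟨ε, hε, hεpos⟩ : ∃ ε : ℝ, 0 < ε ∧
          ∀ k, 0 < B (x + ε • (e k : V)) (x + ε • (e k : V)) := by
        have : ∀ᶠ ε : ℝ in nhdsWithin 0 (Set.Ioi 0),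
            ∀ k, 0 < B (x + ε • (e k : V)) (x + ε • (e k : V)) := by
          rw [Filter.eventually_all]
          intro k
          have hc : Continuous fun ε : ℝ => B (x + ε • (e k : V)) (x + ε • (e k : V)) := by
            simp only [map_add, map_smul, LinearMap.add_apply, LinearMap.smul_apply, smul_eq_mul]
            fun_prop
          have h0 : 0 < B (x + (0 : ℝ) • (e k : V)) (x + (0 : ℝ) • (e k : V)) := by simpa using hx
          exact Filter.Eventually.filter_mono nhdsWithin_le_nhds
            (hc.continuousAt.eventually_const_lt h0)
        obtain ⟨ε, h1, h2⟩ := (this.and self_mem_nhdsWithin).exists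
        exact ⟨ε, h2, h1⟩
      -- For distinct `k`, `l`, the entry in row `k` of column `l` exceeds the diagonal one by `-ε ^
      -- 2 * B (e l) (e l) ≥ 0`, and likewise for row `x`; column `x` is constant. So each diagonal
      -- entry is minimal in its column, and small `ε` keeps it positive.
      refine ⟨Fin.cons x fun k => x + ε • (e k : V), ?_, ?_⟩
      · rw [Fintype.linearIndependent_iff]
        intro c hc
        rw [Fin.sum_univ_succ] at hc
        simp only [Fin.cons_zero, Fin.cons_succ] at hc
        have h1 : c 0 + ∑ k : Fin n, c k.succ = 0 := by
          have := congrArg (fun v => B v x) hc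
          simp only [map_add, map_sum, map_smul, LinearMap.add_apply, LinearMap.smul_apply,
            LinearMap.sum_apply, smul_eq_mul, hWx, mul_zero, add_zero, map_zero,
            LinearMap.zero_apply, ← Finset.sum_mul, ← add_mul] at this
          exact (mul_eq_zero.mp this).resolve_right hx.ne'
        have h2 : ∑ k : Fin n, c k.succ • e k = 0 := by
          have h3 : ε • ((∑ k : Fin n, c k.succ • e k : W) : V) = 0 := by
            rw [← hc, eq_neg_of_add_eq_zero_left h1]
            simp only [smul_add, Finset.sum_add_distrib, ← Finset.sum_smul, neg_smul,
              Submodule.coe_sum, Submodule.coe_smul, Finset.smul_sum, neg_add_cancel_left]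
            exact Finset.sum_congr rfl fun k _ => smul_comm _ _ _
          exact Subtype.ext ((smul_eq_zero.mp h3).resolve_left hε.ne')
        have h4 := Fintype.linearIndependent_iff.mp e.linearIndependent _ h2
        refine fun i => Fin.cases ?_ h4 i
        simpa [h4] using h1
      · have hee : ∀ k, B (e k) (e k) ≤ 0 := fun k => hB x _ hx (hWx _)
        apply LCPSolvable.of_diag_le
        · exact fun j => Fin.cases (by simpa using hx) (fun k => by simpa using hεpos k) j
        · intro i j
          refine Fin.cases ?_ (fun l => ?_) j <;> refine Fin.cases ?_ (fun k => ?_) i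
          · simp
          · simp [hWx]
          · have := mul_nonneg (mul_nonneg hε.le hε.le) (neg_nonneg.mpr (hee l))
            simp only [Fin.cons_zero, Fin.cons_succ, map_add, map_smul, LinearMap.add_apply,
              LinearMap.smul_apply, smul_eq_mul, hWx]
            linarith
          · by_cases hkl : k = l
            · rw [hkl]
            have := mul_nonneg (mul_nonneg hε.le hε.le) (neg_nonneg.mpr (hee l))
            simp only [Fin.cons_succ, map_add, map_smul, LinearMap.add_apply,
              LinearMap.smul_apply, smul_eq_mul, hWx, he k l hkl]
            linarith
    · push Not at hB
      obtain ⟨x, w, hx, hwx, hw⟩ := hB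
      obtain ⟨y, hy, hQ⟩ := ih (hker x hx)
        (B.domRestrict₁₂ (LinearMap.ker (B.flip x)) (LinearMap.ker (B.flip x)))
        ⟨⟨w, by simpa using hwx⟩, hw⟩
      have hyx : ∀ k, B (y k) x = 0 := fun k => LinearMap.mem_ker.mp (y k).2
      refine ⟨Fin.cons x fun k => (y k : V), ?_, LCPSolvable.of_block (by simpa using hx)
        (fun k => by simpa using hyx k) hQ⟩
      rw [linearIndependent_finCons]
      refine ⟨hy.map' _ (Submodule.ker_subtype _), fun hmem => hx.ne' ?_⟩
      have hle : Submodule.span ℝ (Set.range fun k => (y k : V)) ≤ LinearMap.ker (B.flip x) :=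
        Submodule.span_le.mpr (by rintro _ ⟨k, rfl⟩; exact (y k).2)
      simpa using hle hmem

end BilinearForm

/-! ### Strongly monotone variational inequalities -/

section Cones

variable {E : Type*} [NormedAddCommGroup E] [InnerProductSpace ℝ E] [FiniteDimensional ℝ E]

theorem exists_pos_mul_norm_sq_le_inner {A : E →ₗ[ℝ] E} (hA : ∀ x, x ≠ 0 → 0 < inner ℝ x (A x)) :
    ∃ c : ℝ, 0 < c ∧ ∀ x, c * ‖x‖ ^ 2 ≤ inner ℝ x (A x) := by
  have hAc : Continuous A := A.continuous_of_finiteDimensional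
  have hc : Continuous fun x => inner ℝ x (A x) := continuous_id.inner hAc
  rcases (Metric.sphere (0 : E) 1).eq_empty_or_nonempty with he | hne
  · refine ⟨1, one_pos, fun x => ?_⟩
    by_cases hx : x = 0
    · simp [hx]
    · exfalso
      have : ‖x‖⁻¹ • x ∈ Metric.sphere (0 : E) 1 := by
        simp [norm_smul, hx]
      simp [he] at this
  obtain ⟨y, hy, hmin⟩ := (isCompact_sphere (0 : E) 1).exists_isMinOn hne hc.continuousOn
  have hy1 : ‖y‖ = 1 := by simpa using hy
  refine ⟨inner ℝ y (A y), hA y (by rintro rfl; simp at hy1), fun x => ?_⟩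
  by_cases hx : x = 0
  · simp [hx]
  have hxn : 0 < ‖x‖ := norm_pos_iff.mpr hx
  have hm : ‖x‖⁻¹ • x ∈ Metric.sphere (0 : E) 1 := by simp [norm_smul, hx]
  have h : inner ℝ y (A y) ≤ inner ℝ (‖x‖⁻¹ • x) (A (‖x‖⁻¹ • x)) := hmin hm
  rw [map_smul, real_inner_smul_left, real_inner_smul_right, ← mul_assoc, ← sq, inv_pow] at h
  calc inner ℝ y (A y) * ‖x‖ ^ 2 ≤ ((‖x‖ ^ 2)⁻¹ * inner ℝ x (A x)) * ‖x‖ ^ 2 := by gcongr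
    _ = inner ℝ x (A x) := by field_simp

/-- Solvability of strongly monotone linear variational inequalities. -/
theorem exists_variationalInequality {A : E →ₗ[ℝ] E} (hA : ∀ x, x ≠ 0 → 0 < inner ℝ x (A x))
    {K : Set E} (hne : K.Nonempty) (hcl : IsClosed K) (hconv : Convex ℝ K) (q : E) :
    ∃ x ∈ K, ∀ y ∈ K, 0 ≤ inner ℝ (A x + q) (y - x) := by
  obtain ⟨c, hc, hcA⟩ := exists_pos_mul_norm_sq_le_inner hA
  -- A solution is a fixed point of `x ↦ p (x - ρ • (A x + q))`, with `p` the nonexpansive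
  -- projection onto `K`.
  have hproj : ∀ u : E, ∃ v ∈ K, ∀ w ∈ K, inner ℝ (u - v) (w - v) ≤ 0 := fun u => by
    obtain ⟨v, hv, h⟩ := exists_norm_eq_iInf_of_complete_convex hne hcl.isComplete hconv u
    exact ⟨v, hv, (norm_eq_iInf_iff_real_inner_le_zero hconv hv).mp h⟩
  choose p hpK hp using hproj
  have hplip : ∀ u v, ‖p u - p v‖ ≤ ‖u - v‖ := by
    intro u v
    have h1 := hp u (p v) (hpK v)
    have h2 := hp v (p u) (hpK u)
    have h3 : ‖p u - p v‖ * ‖p u - p v‖ ≤ inner ℝ (u - v) (p u - p v) := by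
      rw [← real_inner_self_eq_norm_mul_norm]
      simp only [inner_sub_left, inner_sub_right] at h1 h2 ⊢
      rw [real_inner_comm (p u) (p v)] at *
      linarith
    have h4 := h3.trans (real_inner_le_norm _ _)
    by_contra hlt
    push Not at hlt
    nlinarith [norm_nonneg (u - v)]
  set T : E →L[ℝ] E := LinearMap.toContinuousLinearMap A with hT
  have hTA : ∀ x, ‖A x‖ ≤ ‖T‖ * ‖x‖ := fun x => T.le_opNorm x
  set L : ℝ := ‖T‖ + c with hL
  have hL0 : 0 < L := by positivity
  have hcL : c ≤ L := by rw [hL]; linarith [norm_nonneg T]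
  -- This minimises `1 - 2 * ρ * c + ρ ^ 2 * L ^ 2`, the bound on the squared contraction factor,
  -- with value `1 - ρ * c`.
  set ρ : ℝ := c / L ^ 2 with hρ
  have hρ0 : 0 < ρ := by positivity
  have hρL : ρ * L ^ 2 = c := div_mul_cancel₀ _ (by positivity)
  have hstep : ∀ z : E, ‖z - ρ • A z‖ ≤ √(1 - ρ * c) * ‖z‖ := by
    intro z
    have h1 : ‖z - ρ • A z‖ ^ 2 ≤ (1 - ρ * c) * ‖z‖ ^ 2 := by
      rw [norm_sub_sq_real, real_inner_smul_right, norm_smul, Real.norm_of_nonneg hρ0.le]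
      have h2 : ‖A z‖ ≤ L * ‖z‖ := (hTA z).trans (by gcongr; linarith)
      have h3 : ‖A z‖ ^ 2 ≤ (L * ‖z‖) ^ 2 := by gcongr
      have h4 : (ρ * ‖A z‖) ^ 2 ≤ ρ * c * ‖z‖ ^ 2 := by
        calc (ρ * ‖A z‖) ^ 2 = ρ ^ 2 * ‖A z‖ ^ 2 := by ring
          _ ≤ ρ ^ 2 * (L * ‖z‖) ^ 2 := by gcongr
          _ = ρ * (ρ * L ^ 2) * ‖z‖ ^ 2 := by ring
          _ = _ := by rw [hρL]
      have h5 := mul_le_mul_of_nonneg_left (hcA z) hρ0.le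
      linarith
    calc ‖z - ρ • A z‖ ≤ √((1 - ρ * c) * ‖z‖ ^ 2) := Real.le_sqrt_of_sq_le h1
      _ = _ := by rw [Real.sqrt_mul' _ (sq_nonneg _), Real.sqrt_sq (norm_nonneg _)]
  have hlt : √(1 - ρ * c) < 1 := by
    rw [Real.sqrt_lt' one_pos]
    nlinarith [mul_pos hρ0 hc]
  have hcontr : ContractingWith ⟨√(1 - ρ * c), Real.sqrt_nonneg _⟩
      fun x => p (x - ρ • (A x + q)) := by
    refine ⟨hlt, LipschitzWith.of_dist_le_mul fun x y => ?_⟩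
    rw [dist_eq_norm, dist_eq_norm]
    refine (hplip _ _).trans ?_
    have : x - ρ • (A x + q) - (y - ρ • (A y + q)) = (x - y) - ρ • A (x - y) := by
      rw [map_sub]
      module
    rw [this]
    exact hstep _
  obtain ⟨x, hx⟩ : ∃ x, p (x - ρ • (A x + q)) = x := ⟨_, hcontr.fixedPoint_isFixedPt⟩
  refine ⟨x, hx ▸ hpK _, fun y hy => ?_⟩
  have h := hp (x - ρ • (A x + q)) y hy
  rw [hx, sub_sub_cancel_left, inner_neg_left, real_inner_smul_left] at h
  have : 0 ≤ ρ * inner ℝ (A x + q) (y - x) := by linarith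
  exact nonneg_of_mul_nonneg_right this hρ0

end Cones

/-! ### Simplicial cones and the F-, Q- and P-properties -/

section SimplicialCone

variable {m : ℕ} {K : Set (EuclideanSpace ℝ (Fin m))}
  {A : EuclideanSpace ℝ (Fin m) →ₗ[ℝ] EuclideanSpace ℝ (Fin m)}

theorem generator_mem_cone (x : Fin m → EuclideanSpace ℝ (Fin m)) (i : Fin m) :
    x i ∈ {y | ∃ t : Fin m → ℝ, (∀ i, 0 ≤ t i) ∧ y = ∑ i, t i • x i} :=
  ⟨Pi.single i 1, fun j => by by_cases h : j = i <;> simp [h],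
    by simp [Pi.single_apply]⟩

theorem IsSimplicialCone.isClosed (hK : IsSimplicialCone K) : IsClosed K := by
  obtain ⟨x, hx, rfl⟩ := hK
  have hemb := LinearMap.isClosedEmbedding_of_injective
    (f := Fintype.linearCombination ℝ x) (LinearMap.ker_eq_bot.mpr
      hx.fintypeLinearCombination_injective)
  have himg : {y | ∃ t : Fin m → ℝ, (∀ i, 0 ≤ t i) ∧ y = ∑ i, t i • x i}
      = Fintype.linearCombination ℝ x '' Set.Ici 0 := by
    ext y
    simp [Fintype.linearCombination_apply, Pi.le_def, eq_comm]
  rw [himg]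
  exact hemb.isClosedMap _ isClosed_Ici

theorem IsSimplicialCone.zero_mem (hK : IsSimplicialCone K) : (0 : EuclideanSpace ℝ (Fin m)) ∈ K := by
  obtain ⟨x, hx, rfl⟩ := hK
  exact ⟨0, by simp, by simp⟩

theorem IsSimplicialCone.add_mem (hK : IsSimplicialCone K) {a b : EuclideanSpace ℝ (Fin m)}
    (ha : a ∈ K) (hb : b ∈ K) : a + b ∈ K := by
  obtain ⟨x, hx, rfl⟩ := hK
  obtain ⟨s, hs, rfl⟩ := ha
  obtain ⟨t, ht, rfl⟩ := hb
  exact ⟨s + t, fun i => add_nonneg (hs i) (ht i), by simp [add_smul, Finset.sum_add_distrib]⟩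

theorem IsSimplicialCone.smul_mem (hK : IsSimplicialCone K) {c : ℝ} (hc : 0 ≤ c)
    {a : EuclideanSpace ℝ (Fin m)} (ha : a ∈ K) : c • a ∈ K := by
  obtain ⟨x, hx, rfl⟩ := hK
  obtain ⟨s, hs, rfl⟩ := ha
  exact ⟨c • s, fun i => mul_nonneg hc (hs i), by simp [Finset.smul_sum, mul_smul]⟩

theorem IsSimplicialCone.convex (hK : IsSimplicialCone K) : Convex ℝ K :=
  fun _ ha _ hb _ _ hs ht _ => hK.add_mem (hK.smul_mem hs ha) (hK.smul_mem ht hb)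

theorem HasQProperty.hasFProperty (h : HasQProperty K A) : HasFProperty K A := fun q => by
  obtain ⟨x, hx, hd, -⟩ := h q
  exact ⟨A x + q, ⟨x, hx, rfl⟩, hd⟩

theorem HasPProperty.hasQProperty (h : HasPProperty K A) : HasQProperty K A :=
  fun q => (h q).exists

theorem hasPProperty_of_pos (hA : ∀ x, x ≠ 0 → 0 < inner ℝ x (A x)) (hK : IsSimplicialCone K) :
    HasPProperty K A := by
  intro q
  obtain ⟨x, hx, hvi⟩ := exists_variationalInequality hA ⟨0, hK.zero_mem⟩ hK.isClosed hK.convex q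
  have h0 : inner ℝ x (A x + q) = 0 := by
    -- Testing against `0` and `2x` bounds the inner product from both sides.
    have h1 := hvi 0 hK.zero_mem
    have h2 := hvi (x + x) (hK.add_mem hx hx)
    rw [zero_sub, inner_neg_right] at h1
    rw [add_sub_cancel_right] at h2
    rw [real_inner_comm]
    linarith
  refine ⟨x, ⟨hx, fun y hy => ?_, h0⟩, fun y ⟨hy, hyd, hy0⟩ => ?_⟩
  · have := hvi y hy
    rw [inner_sub_right, real_inner_comm x, h0, sub_zero] at this
    simpa [real_inner_comm] using this
  · by_contra hne
    have hpos := hA (y - x) (sub_ne_zero.mpr hne)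
    have h1 : 0 ≤ inner ℝ x (A y + q) := hyd hx
    have h2 := hvi y hy
    have h3 : inner ℝ (y - x) (A (y - x))
        = inner ℝ y (A y + q) - inner ℝ x (A y + q) - inner ℝ (A x + q) (y - x) := by
      rw [real_inner_comm (y - x) (A x + q), map_sub]
      simp only [inner_sub_left, inner_sub_right, inner_add_right]
      ring
    rw [h3, hy0] at hpos
    linarith

/-- A nonzero vector in a half-space can be completed to a basis inside the half-space. -/
theorem exists_linearIndependent_nonpos {x : EuclideanSpace ℝ (Fin m)} (hx : x ≠ 0)
    (f : EuclideanSpace ℝ (Fin m) →ₗ[ℝ] ℝ) (hf : f x ≤ 0) :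
    ∃ v : Fin m → EuclideanSpace ℝ (Fin m), LinearIndependent ℝ v ∧ (∀ i, f (v i) ≤ 0) ∧
      ∃ i, v i = x := by
  obtain - | n := m
  · exact absurd (Subsingleton.elim x 0) hx
  obtain ⟨φ, hφx⟩ : ∃ φ : Module.Dual ℝ (EuclideanSpace ℝ (Fin (n + 1))), φ x ≠ 0 :=
    ⟨innerₛₗ ℝ x, by simpa using hx⟩
  have hker : Module.finrank ℝ (LinearMap.ker φ) = n := by
    have := Module.Dual.finrank_ker_add_one_of_ne_zero (f := φ) (fun h => hφx (by simp [h]))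
    simpa using this
  obtain ⟨e, he, heφ⟩ : ∃ e : Fin n → EuclideanSpace ℝ (Fin (n + 1)),
      LinearIndependent ℝ e ∧ ∀ k, φ (e k) = 0 := by
    obtain ⟨b⟩ : Nonempty (Module.Basis (Fin n) ℝ (LinearMap.ker φ)) :=
      ⟨Module.finBasisOfFinrankEq ℝ _ hker⟩
    exact ⟨fun k => b k, b.linearIndependent.map' (LinearMap.ker φ).subtype
      (Submodule.ker_subtype _),
      fun k => LinearMap.mem_ker.mp (b k).2⟩
  -- Flipping signs moves each basis vector of the complement into the half-space.
  obtain ⟨s, hs⟩ : ∃ s : Fin n → ℝˣ, ∀ k, (s k : ℝ) * f (e k) ≤ 0 := by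
    have : ∀ k, ∃ s : ℝˣ, (s : ℝ) * f (e k) ≤ 0 := fun k => by
      rcases le_total (f (e k)) 0 with h | h
      · exact ⟨1, by simpa using h⟩
      · exact ⟨-1, by simpa using h⟩
    choose s hs using this
    exact ⟨s, hs⟩
  refine ⟨Fin.cons x (s • e), ?_, fun i => ?_, 0, rfl⟩
  · rw [linearIndependent_finCons]
    refine ⟨he.units_smul s, fun hmem => hφx ?_⟩
    have hle : Submodule.span ℝ (Set.range (s • e)) ≤ LinearMap.ker φ :=
      Submodule.span_le.mpr (by
        rintro _ ⟨k, rfl⟩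
        simp [Units.smul_def, heφ])
    exact LinearMap.mem_ker.mp (hle hmem)
  · refine Fin.cases (by simpa using hf) (fun k => ?_) i
    simpa [Units.smul_def] using hs k

theorem exists_not_hasFProperty {x : EuclideanSpace ℝ (Fin m)} (hx : x ≠ 0)
    (hxA : inner ℝ x (A x) ≤ 0) : ∃ K, IsSimplicialCone K ∧ ¬ HasFProperty K A := by
  obtain ⟨v, hv, hvA, i₀, hi₀⟩ := exists_linearIndependent_nonpos hx (innerₛₗ ℝ x ∘ₗ A) hxA
  refine ⟨_, ⟨v, hv, rfl⟩, fun hF => ?_⟩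
  obtain ⟨_, ⟨y, ⟨t, ht, rfl⟩, rfl⟩, hd⟩ := hF (-x)
  have h1 : (0 : ℝ) ≤ inner ℝ x (A (∑ i, t i • v i) + -x) :=
    hd (hi₀ ▸ generator_mem_cone v i₀)
  have h2 : inner ℝ x (A (∑ i, t i • v i)) ≤ 0 := by
    rw [map_sum, inner_sum]
    refine Finset.sum_nonpos fun i _ => ?_
    rw [map_smul, real_inner_smul_right]
    exact mul_nonpos_of_nonneg_of_nonpos (ht i) (hvA i)
  have h3 : 0 < inner ℝ x x := real_inner_self_pos.mpr hx
  rw [inner_add_right, inner_neg_right] at h1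
  linarith

/-- Choose `e` with inner product `1` against every generator. Feasibility for `-e` gives `⟨y, A y⟩
≥ ⟨y, e⟩ = ∑ i, t i`, and `y = 0` is excluded because `-e` is not in the dual cone. -/
theorem HasFProperty.exists_pos (hm : 0 < m) (hK : IsSimplicialCone K) (hF : HasFProperty K A) :
    ∃ x, 0 < inner ℝ x (A x) := by
  obtain ⟨x, hx, rfl⟩ := hK
  have : Nonempty (Fin m) := ⟨⟨0, hm⟩⟩
  let b := basisOfLinearIndependentOfCardEqFinrank hx (by simp)
  let e := (InnerProductSpace.toDual ℝ (EuclideanSpace ℝ (Fin m))).symm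
    (LinearMap.toContinuousLinearMap (b.constr ℝ fun _ => (1 : ℝ)))
  have he : ∀ i, inner ℝ (x i) e = 1 := by
    intro i
    have hb : b i = x i := by simp [b]
    rw [real_inner_comm, InnerProductSpace.toDual_symm_apply, ← hb]
    simp
  obtain ⟨_, ⟨y, hy, rfl⟩, hd⟩ := hF (-e)
  have h1 : (0 : ℝ) ≤ inner ℝ y (A y + -e) := hd hy
  rw [inner_add_right, inner_neg_right] at h1
  refine ⟨y, ?_⟩
  obtain ⟨t, ht, rfl⟩ := hy
  have h2 : inner ℝ (∑ i, t i • x i) e = ∑ i, t i := by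
    simp [sum_inner, real_inner_smul_left, he]
  rw [h2] at h1
  rcases (Finset.sum_nonneg fun i _ => ht i : 0 ≤ ∑ i, t i).lt_or_eq with h3 | h3
  · linarith
  · exfalso
    have h4 : ∀ i, t i = 0 := fun i =>
      (Finset.sum_eq_zero_iff_of_nonneg fun i _ => ht i).mp h3.symm i (Finset.mem_univ i)
    have h5 : (0 : ℝ) ≤ inner ℝ (x ⟨0, hm⟩) (A (∑ i, t i • x i) + -e) :=
      hd (generator_mem_cone x _)
    simp only [h4, zero_smul, Finset.sum_const_zero, map_zero, zero_add, inner_neg_right, he] at h5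
    linarith

theorem exists_hasQProperty_of_pos (h : ∃ x, 0 < inner ℝ x (A x)) :
    ∃ L, IsSimplicialCone L ∧ HasQProperty L A := by
  let B : EuclideanSpace ℝ (Fin m) →ₗ[ℝ] EuclideanSpace ℝ (Fin m) →ₗ[ℝ] ℝ :=
    (innerₗ (EuclideanSpace ℝ (Fin m))).compl₂ A
  obtain ⟨y, hy, hQ⟩ := exists_linearIndependent_lcpSolvable m (by simp) B h
  refine ⟨_, ⟨y, hy, rfl⟩, fun q => ?_⟩
  obtain ⟨z, hz, hw, hzw⟩ := hQ fun i => inner ℝ (y i) q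
  have hrow : ∀ i, ∑ j, inner ℝ (y i) (A (y j)) * z j + inner ℝ (y i) q
      = inner ℝ (y i) (A (∑ j, z j • y j) + q) := by
    intro i
    simp [inner_add_right, inner_sum, real_inner_smul_right, mul_comm]
  have hw' : ∀ i, 0 ≤ inner ℝ (y i) (A (∑ j, z j • y j) + q) := fun i => hrow i ▸ hw i
  have hzw' : ∀ i, z i * inner ℝ (y i) (A (∑ j, z j • y j) + q) = 0 := fun i => hrow i ▸ hzw i
  refine ⟨∑ j, z j • y j, ⟨z, hz, rfl⟩, ?_, ?_⟩
  · rintro _ ⟨t, ht, rfl⟩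
    change (0 : ℝ) ≤ inner ℝ (∑ i, t i • y i) _
    rw [sum_inner]
    refine Finset.sum_nonneg fun i _ => ?_
    rw [real_inner_smul_left]
    exact mul_nonneg (ht i) (hw' i)
  · rw [sum_inner]
    refine Finset.sum_eq_zero fun i _ => ?_
    rw [real_inner_smul_left]
    exact hzw' i

theorem isSimplicialCone_orthant (m : ℕ) :
    ∃ K : Set (EuclideanSpace ℝ (Fin m)), IsSimplicialCone K :=
  ⟨_, _, (EuclideanSpace.basisFun (Fin m) ℝ).toBasis.linearIndependent, rfl⟩

end SimplicialCone

/-! ### The equivalences and the trichotomy -/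

theorem corollary6p15 (m : ℕ)
    (A : EuclideanSpace ℝ (Fin m) →ₗ[ℝ] EuclideanSpace ℝ (Fin m)) (hA : IsUnit A) :
    ((∀ K, IsSimplicialCone K → HasFProperty K A) ↔
      (∀ K, IsSimplicialCone K → HasQProperty K A)) ∧
    ((∀ K, IsSimplicialCone K → HasQProperty K A) ↔
      (∀ K, IsSimplicialCone K → HasPProperty K A)) ∧
    ExactlyOneOfThree
      (∀ K, IsSimplicialCone K → HasFProperty K A)
      (¬ ∃ K, IsSimplicialCone K ∧ HasFProperty K A)
      ((∃ K, IsSimplicialCone K ∧ ¬ HasFProperty K A) ∧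
        (∃ L, IsSimplicialCone L ∧ HasQProperty L A)) := by
  have hFP : (∀ K, IsSimplicialCone K → HasFProperty K A) →
      ∀ K, IsSimplicialCone K → HasPProperty K A := by
    intro hF K hK
    refine hasPProperty_of_pos (fun x hx => ?_) hK
    by_contra hle
    obtain ⟨L, hL, hLF⟩ := exists_not_hasFProperty hx (not_lt.mp hle)
    exact hLF (hF L hL)
  refine ⟨⟨fun hF K hK => (hFP hF K hK).hasQProperty, fun hQ K hK => (hQ K hK).hasFProperty⟩,
    ⟨fun hQ => hFP fun K hK => (hQ K hK).hasFProperty, fun hP K hK => (hP K hK).hasQProperty⟩,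
    ?_, ?_, ?_, ?_⟩
  · by_cases hall : ∀ K, IsSimplicialCone K → HasFProperty K A
    · exact Or.inl hall
    by_cases hnone : ∃ K, IsSimplicialCone K ∧ HasFProperty K A
    · refine Or.inr (Or.inr ⟨by push Not at hall; exact hall, ?_⟩)
      obtain ⟨K, hK, hF⟩ := hnone
      -- In dimension `0` positive definiteness is vacuous, so the first alternative holds.
      rcases Nat.eq_zero_or_pos m with rfl | hm
      · exact absurd (fun L hL => (hasPProperty_of_pos
          (fun x hx => absurd (Subsingleton.elim x 0) hx) hL).hasQProperty.hasFProperty) hall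
      · exact exists_hasQProperty_of_pos (hF.exists_pos hm hK)
    · exact Or.inr (Or.inl hnone)
  · rintro ⟨hall, hnone⟩
    obtain ⟨K, hK⟩ := isSimplicialCone_orthant m
    exact hnone ⟨K, hK, hall K hK⟩
  · rintro ⟨hall, ⟨K, hK, hKF⟩, -⟩
    exact hKF (hall K hK)
  · rintro ⟨hnone, -, L, hL, hQ⟩
    exact hnone ⟨L, hL, hQ.hasFProperty⟩
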